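/- Let $M$ be a smooth manifold of dimension $d$ with a smooth Lorentzian metric $g$ of signature $(-,+,\dots,+)$ and Levi-Civita connection $\nabla$, let $0<p<d-2$, and let $\ell$ be a smooth, nowhere-zero null vector field on $M$. A *null frame* at a point containing $\ell$ consists of tangent vectors $e_{(0)}=\ell$, $e_{(1)}=n$, $e_{(i)}=m_{(i)}$ ($i=2,\dots,d-1$) whose only non-vanishing scalar products are $\ell\cdot n=1$ and $m_{(i)}\cdot m_{(j)}=\delta_{ij}$. The *boost weight* of the frame component $F_{a_1\dots a_k}=F(e_{(a_1)},\dots,e_{(a_k)})$ is the number of indices equal to $0$ minus the number of indices equal to $1$. Put $$\kappa_i=m_{(i)}\cdot\nabla_\ell\,\ell,\qquad \rho_{ij}=m_{(i)}\cdot\nabla_{m_{(j)}}\ell,\qquad \rho=\sum_i\rho_{ii},\qquad \rho_{(ij)}=\tfrac12(\rho_{ij}+\rho_{ji}).$$ Let $F$ be a smooth $(p+1)$-form on $M$ satisfying the Maxwell equations $\nabla^\mu F_{\mu\nu_1\dots\nu_p}=0$ and $\nabla_{[\nu_1}F_{\nu_2\dots\nu_{p+2}]}=0$, and suppose that $\ell$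 is *multiply aligned* with $F$: at every point, in a null frame containing $\ell$, all components of $F$ of non-negative boost weight vanish (this does not depend on the choice of $n$ and $m_{(i)}$). Then at every point $x\in M$ with $F_x\neq0$ (hence on all of $M$ if $F$ vanishes nowhere): (i) $\ell$ is geodesic: $\nabla_\ell\,\ell$ is a multiple of $\ell$, and $\kappa_i=0$ for all $i$ in every null frame at $x$ containing $\ell$. (ii) In every null frame at $x$ containing $\ell$, the symmetric matrix $\rho_{(ij)}$ has, among its $d-2$ eigenvalues counted with multiplicity, $p$ eigenvalues whose sum is $\rho/2$, and the remaining $d-2-p$ eigenvalues also sum to $\rho/2$. -/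

import Mathlib

open Bundle Module VectorField
open scoped Manifold ContDiff Topology

noncomputable section

namespace Spacetime

/-! ### Lorentzian metrics and the Levi-Civita connection -/

/-- A smooth Lorentzian metric, of signature `(-, +, …, +)`, on the `d`-dimensional smooth
manifold `M`. -/
structure LorentzMetric (d : ℕ) (M : Type*) [TopologicalSpace M]
    [ChartedSpace (EuclideanSpace ℝ (Fin d)) M] [IsManifold (𝓡 d) ∞ M] where
  /-- The scalar product on each tangent space. -/
  val (x : M) : TangentSpace (𝓡 d) x →L[ℝ] TangentSpace (𝓡 d) x →L[ℝ] ℝ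
  symm (x : M) (v w : TangentSpace (𝓡 d) x) : val x v w = val x w v
  /-- There is a timelike vector, and the metric is positive definite on its orthogonal
  complement. -/
  lorentzian (x : M) : ∃ t : TangentSpace (𝓡 d) x, val x t t < 0 ∧
    ∀ w : TangentSpace (𝓡 d) x, val x t w = 0 → w ≠ 0 → 0 < val x w w
  contMDiff : ContMDiff (𝓡 d)
    ((𝓡 d).prod 𝓘(ℝ, EuclideanSpace ℝ (Fin d) →L[ℝ] EuclideanSpace ℝ (Fin d) →L[ℝ] ℝ)) ∞
    (fun x ↦ TotalSpace.mk'
      (EuclideanSpace ℝ (Fin d) →L[ℝ] EuclideanSpace ℝ (Fin d) →L[ℝ] ℝ)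
      (E := fun x : M ↦ TangentSpace (𝓡 d) x →L[ℝ] TangentSpace (𝓡 d) x →L[ℝ] ℝ) x (val x))

variable {d : ℕ} {M : Type*} [TopologicalSpace M]
  [ChartedSpace (EuclideanSpace ℝ (Fin d)) M] [IsManifold (𝓡 d) ∞ M]

/-- Differentiability at a point of a vector field on `M`. -/
abbrev DiffAt (X : Π x : M, TangentSpace (𝓡 d) x) (x : M) : Prop :=
  MDifferentiableAt (𝓡 d) ((𝓡 d).prod 𝓘(ℝ, EuclideanSpace ℝ (Fin d)))
    (fun y ↦ TotalSpace.mk' (EuclideanSpace ℝ (Fin d)) y (X y)) x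

/-- A smooth vector field (smooth near `x`) with the value `v` at `x`: its components in the
preferred chart at `x` are constant. -/
abbrev extend {x : M} (v : TangentSpace (𝓡 d) x) : Π y : M, TangentSpace (𝓡 d) y :=
  FiberBundle.extend (EuclideanSpace ℝ (Fin d)) v

theorem diffAt_extend {x : M} (v : TangentSpace (𝓡 d) x) : DiffAt (extend v) x :=
  FiberBundle.mdifferentiableAt_extend (𝓡 d) (EuclideanSpace ℝ (Fin d)) v

theorem extend_self {x : M} (v : TangentSpace (𝓡 d) x) : extend v x = v :=
  FiberBundle.extend_apply_self (EuclideanSpace ℝ (Fin d)) v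

namespace LorentzMetric

theorem nondegenerate (g : LorentzMetric d M) (x : M) (v : TangentSpace (𝓡 d) x)
    (h : ∀ w, g.val x v w = 0) : v = 0 := by
  obtain ⟨t, ht, hpos⟩ := g.lorentzian x
  by_contra hv
  have h1 : g.val x t v = 0 := by rw [g.symm]; exact h t
  have h2 := hpos v h1 hv
  rw [h v] at h2
  exact lt_irrefl _ h2

/-- Lowering an index, `v ↦ g(v, ·)`, as a linear isomorphism from the tangent space to its
dual. -/
def flat (g : LorentzMetric d M) (x : M) :
    TangentSpace (𝓡 d) x ≃ₗ[ℝ] (TangentSpace (𝓡 d) x →L[ℝ] ℝ) :=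
  haveI : FiniteDimensional ℝ (TangentSpace (𝓡 d) x) :=
    inferInstanceAs (FiniteDimensional ℝ (EuclideanSpace ℝ (Fin d)))
  haveI : T2Space (TangentSpace (𝓡 d) x) :=
    inferInstanceAs (T2Space (EuclideanSpace ℝ (Fin d)))
  haveI : FiniteDimensional ℝ (TangentSpace (𝓡 d) x →L[ℝ] ℝ) :=
    LinearEquiv.finiteDimensional
      (LinearMap.toContinuousLinearMap (𝕜 := ℝ) (E := TangentSpace (𝓡 d) x) (F' := ℝ))
  LinearEquiv.ofInjectiveOfFinrankEq ((g.val x : TangentSpace (𝓡 d) x →L[ℝ] _) :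
      TangentSpace (𝓡 d) x →ₗ[ℝ] (TangentSpace (𝓡 d) x →L[ℝ] ℝ))
    (by
      rw [← LinearMap.ker_eq_bot, LinearMap.ker_eq_bot']
      intro v hv
      exact g.nondegenerate x v fun w ↦ by
        have := congrArg (fun f : TangentSpace (𝓡 d) x →L[ℝ] ℝ ↦ f w) hv
        simpa using this)
    (by
      rw [← (LinearMap.toContinuousLinearMap (𝕜 := ℝ) (E := TangentSpace (𝓡 d) x)
        (F' := ℝ)).finrank_eq]
      exact (Subspace.dual_finrank_eq (K := ℝ) (V := TangentSpace (𝓡 d) x)).symm)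

@[simp] theorem flat_apply (g : LorentzMetric d M) (x : M) (v w : TangentSpace (𝓡 d) x) :
    g.flat x v w = g.val x v w := rfl

theorem val_flat_symm (g : LorentzMetric d M) (x : M) (φ : TangentSpace (𝓡 d) x →L[ℝ] ℝ)
    (w : TangentSpace (𝓡 d) x) : g.val x ((g.flat x).symm φ) w = φ w := by
  rw [← flat_apply, LinearEquiv.apply_symm_apply]

/-- The function `y ↦ g(X, Y)` of two vector fields. -/
def pair (g : LorentzMetric d M) (X Y : Π x : M, TangentSpace (𝓡 d) x) : M → ℝ :=
  fun y ↦ g.val y (X y) (Y y)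

theorem mdifferentiableAt_pair (g : LorentzMetric d M) {X Y : Π x : M, TangentSpace (𝓡 d) x}
    {x : M} (hX : DiffAt X x) (hY : DiffAt Y x) :
    MDifferentiableAt (𝓡 d) 𝓘(ℝ, ℝ) (g.pair X Y) x := by
  have h1 := (g.contMDiff.mdifferentiable (by simp)) x
  have h := MDifferentiableAt.clm_bundle_apply₂ (F₁ := EuclideanSpace ℝ (Fin d))
    (F₂ := EuclideanSpace ℝ (Fin d)) (F₃ := ℝ)
    (E₁ := fun x : M ↦ TangentSpace (𝓡 d) x) (E₂ := fun x : M ↦ TangentSpace (𝓡 d) x)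
    (E₃ := Bundle.Trivial M ℝ) (b := fun y : M ↦ y) (ψ := g.val) h1 hX hY
  rw [mdifferentiableAt_totalSpace] at h
  exact h.2

/-- Half of the right-hand side of the Koszul formula
`2 g(∇_X σ, W) = X g(σ, W) + σ g(X, W) - W g(X, σ)
  + g([X, σ], W) - g([X, W], σ) - g([σ, W], X)`. -/
def koszul (g : LorentzMetric d M) (σ X W : Π x : M, TangentSpace (𝓡 d) x) (x : M) : ℝ :=
  (1 / 2 : ℝ) *
    (mvfderiv (𝓡 d) (g.pair σ W) x (X x) + mvfderiv (𝓡 d) (g.pair X W) x (σ x)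
      - mvfderiv (𝓡 d) (g.pair X σ) x (W x)
      + g.val x (mlieBracket (𝓡 d) X σ x) (W x) - g.val x (mlieBracket (𝓡 d) X W x) (σ x)
      - g.val x (mlieBracket (𝓡 d) σ W x) (X x))

theorem pair_comm (g : LorentzMetric d M) (X Y : Π x : M, TangentSpace (𝓡 d) x) :
    g.pair X Y = g.pair Y X := funext fun y ↦ g.symm y _ _

theorem pair_add (g : LorentzMetric d M) (X Y Z : Π x : M, TangentSpace (𝓡 d) x) :
    g.pair X (Y + Z) = g.pair X Y + g.pair X Z := by
  funext y; simp [pair]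

theorem add_pair (g : LorentzMetric d M) (X Y Z : Π x : M, TangentSpace (𝓡 d) x) :
    g.pair (X + Y) Z = g.pair X Z + g.pair Y Z := by
  funext y; simp [pair]

theorem pair_smul (g : LorentzMetric d M) (f : M → ℝ) (X Y : Π x : M, TangentSpace (𝓡 d) x) :
    g.pair X (f • Y) = f * g.pair X Y := by
  funext y; simp [pair]

theorem smul_pair (g : LorentzMetric d M) (f : M → ℝ) (X Y : Π x : M, TangentSpace (𝓡 d) x) :
    g.pair (f • X) Y = f * g.pair X Y := by
  funext y; simp [pair]

theorem tensorialAt_koszul_left (g : LorentzMetric d M) {σ W : Π x : M, TangentSpace (𝓡 d) x}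
    {x : M} (hσ : DiffAt σ x) (hW : DiffAt W x) :
    TensorialAt (𝓡 d) (EuclideanSpace ℝ (Fin d)) (fun X ↦ g.koszul σ X W x) x where
  smul {f X} hf hX := by
    simp only [koszul, smul_pair, mvfderiv_mul hf (g.mdifferentiableAt_pair hX hW),
      mvfderiv_mul hf (g.mdifferentiableAt_pair hX hσ), mlieBracket_smul_left hf hX]
    simp [pair]
    rw [g.symm x (X x) (W x), g.symm x (X x) (σ x)]
    ring
  add {X X'} hX hX' := by
    simp only [koszul, add_pair, mvfderiv_add (g.mdifferentiableAt_pair hX hW)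
      (g.mdifferentiableAt_pair hX' hW), mvfderiv_add (g.mdifferentiableAt_pair hX hσ)
      (g.mdifferentiableAt_pair hX' hσ), mlieBracket_add_left hX hX']
    simp
    ring

theorem tensorialAt_koszul_right (g : LorentzMetric d M) {σ X : Π x : M, TangentSpace (𝓡 d) x}
    {x : M} (hσ : DiffAt σ x) (hX : DiffAt X x) :
    TensorialAt (𝓡 d) (EuclideanSpace ℝ (Fin d)) (fun W ↦ g.koszul σ X W x) x where
  smul {f W} hf hW := by
    simp only [koszul, pair_smul, mvfderiv_mul hf (g.mdifferentiableAt_pair hX hW),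
      mvfderiv_mul hf (g.mdifferentiableAt_pair hσ hW), mlieBracket_smul_right hf hW]
    simp [pair]
    rw [g.symm x (W x) (σ x), g.symm x (W x) (X x)]
    ring
  add {W W'} hW hW' := by
    simp only [koszul, pair_add, mvfderiv_add (g.mdifferentiableAt_pair hX hW)
      (g.mdifferentiableAt_pair hX hW'), mvfderiv_add (g.mdifferentiableAt_pair hσ hW)
      (g.mdifferentiableAt_pair hσ hW'), mlieBracket_add_right hW hW']
    simp
    ring

theorem koszul_smul (g : LorentzMetric d M) {f : M → ℝ} {σ X W : Π x : M, TangentSpace (𝓡 d) x}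
    {x : M} (hf : MDifferentiableAt (𝓡 d) 𝓘(ℝ, ℝ) f x) (hσ : DiffAt σ x) (hX : DiffAt X x)
    (hW : DiffAt W x) :
    g.koszul (f • σ) X W x
      = f x * g.koszul σ X W x + mvfderiv (𝓡 d) f x (X x) * g.val x (σ x) (W x) := by
  simp only [koszul, pair_smul, smul_pair, mvfderiv_mul hf (g.mdifferentiableAt_pair hX hσ),
    mvfderiv_mul hf (g.mdifferentiableAt_pair hσ hW), mlieBracket_smul_right hf hσ,
    mlieBracket_smul_left hf hσ]
  simp [pair]
  rw [g.symm x (X x) (σ x)]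
  ring

theorem koszul_add (g : LorentzMetric d M) {σ σ' X W : Π x : M, TangentSpace (𝓡 d) x}
    {x : M} (hσ : DiffAt σ x) (hσ' : DiffAt σ' x) (hX : DiffAt X x)
    (hW : DiffAt W x) :
    g.koszul (σ + σ') X W x = g.koszul σ X W x + g.koszul σ' X W x := by
  simp only [koszul, pair_add, add_pair, mvfderiv_add (g.mdifferentiableAt_pair hX hσ)
    (g.mdifferentiableAt_pair hX hσ'), mvfderiv_add (g.mdifferentiableAt_pair hσ hW)
    (g.mdifferentiableAt_pair hσ' hW), mlieBracket_add_left hσ hσ', mlieBracket_add_right hσ hσ']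
  simp
  ring

open Classical in
/-- `(X, W) ↦ g(∇_X σ, W)` at the point `x`, as a bilinear form on the tangent space; the junk
value `0` is taken if `σ` is not differentiable at `x`. -/
def koszulForm (g : LorentzMetric d M) (σ : Π x : M, TangentSpace (𝓡 d) x) (x : M) :
    TangentSpace (𝓡 d) x →L[ℝ] TangentSpace (𝓡 d) x →L[ℝ] ℝ :=
  if hσ : DiffAt σ x then
    TensorialAt.mkHom₂ (fun X W ↦ g.koszul σ X W x) x
      (fun _ hW ↦ g.tensorialAt_koszul_left hσ hW) (fun _ hX ↦ g.tensorialAt_koszul_right hσ hX)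
  else 0

theorem koszulForm_apply (g : LorentzMetric d M) {σ X W : Π x : M, TangentSpace (𝓡 d) x}
    {x : M} (hσ : DiffAt σ x) (hX : DiffAt X x) (hW : DiffAt W x) :
    g.koszulForm σ x (X x) (W x) = g.koszul σ X W x := by
  rw [koszulForm, dif_pos hσ]
  exact TensorialAt.mkHom₂_apply _ _ hX hW

/-- The Levi-Civita connection of `g`: `∇_v σ` is the tangent vector such that `g(∇_v σ, w)` is
given by the Koszul formula for every `w`. As for every covariant derivative in Mathlib,
`g.leviCivita σ x v` is `∇_v σ` at `x`. -/
def leviCivita (g : LorentzMetric d M) :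
    CovariantDerivative (𝓡 d) (EuclideanSpace ℝ (Fin d))
      (fun x : M ↦ TangentSpace (𝓡 d) x) where
  toFun σ x :=
    haveI : FiniteDimensional ℝ (TangentSpace (𝓡 d) x) :=
      inferInstanceAs (FiniteDimensional ℝ (EuclideanSpace ℝ (Fin d)))
    haveI : T2Space (TangentSpace (𝓡 d) x) :=
      inferInstanceAs (T2Space (EuclideanSpace ℝ (Fin d)))
    LinearMap.toContinuousLinearMap
      ((g.flat x).symm.toLinearMap ∘ₗ (g.koszulForm σ x).toLinearMap)
  isCovariantDerivativeOnUniv :=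
    { add := by
        intro σ σ' x hσ hσ' _
        ext v : 1
        apply (g.flat x).injective
        ext w : 1
        have h := g.koszul_add hσ hσ' (diffAt_extend v)
          (diffAt_extend w)
        rw [← g.koszulForm_apply (mdifferentiableAt_add_section hσ hσ')
          (diffAt_extend v) (diffAt_extend w),
          ← g.koszulForm_apply hσ
          (diffAt_extend v) (diffAt_extend w),
          ← g.koszulForm_apply hσ'
          (diffAt_extend v) (diffAt_extend w)] at h
        simpa using h
      leibniz := by
        intro σ f x hσ hf _
        ext v : 1
        apply (g.flat x).injective
        ext w : 1
        have h := g.koszul_smul hf hσ (diffAt_extend v)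
          (diffAt_extend w)
        rw [← g.koszulForm_apply (hf.smul_section hσ)
          (diffAt_extend v) (diffAt_extend w),
          ← g.koszulForm_apply hσ
          (diffAt_extend v) (diffAt_extend w)] at h
        simpa using h }

theorem val_leviCivita (g : LorentzMetric d M) {σ X W : Π x : M, TangentSpace (𝓡 d) x}
    {x : M} (hσ : DiffAt σ x) (hX : DiffAt X x) (hW : DiffAt W x) :
    g.val x (g.leviCivita σ x (X x)) (W x) = g.koszul σ X W x := by
  rw [← g.koszulForm_apply hσ hX hW]
  exact g.val_flat_symm x _ _

/-- The Levi-Civita connection is compatible with the metric. -/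
theorem leviCivita_metric (g : LorentzMetric d M) {σ τ : Π x : M, TangentSpace (𝓡 d) x}
    {x : M} (hσ : DiffAt σ x) (hτ : DiffAt τ x) (v : TangentSpace (𝓡 d) x) :
    mvfderiv (𝓡 d) (fun y ↦ g.val y (σ y) (τ y)) x v
      = g.val x (g.leviCivita σ x v) (τ x) + g.val x (σ x) (g.leviCivita τ x v) := by
  have hv := diffAt_extend v
  have h1 := g.val_leviCivita hσ hv hτ
  have h2 := g.val_leviCivita hτ hv hσ
  rw [extend_self] at h1 h2
  rw [g.symm x (σ x), h1, h2]
  change mvfderiv (𝓡 d) (g.pair σ τ) x v = _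
  simp only [koszul, g.pair_comm τ σ, extend_self]
  rw [mlieBracket_swap_apply (V := σ) (W := τ)]
  simp
  ring

/-- The Levi-Civita connection is torsion-free. -/
theorem leviCivita_torsion (g : LorentzMetric d M) : g.leviCivita.torsion = 0 := by
  rw [CovariantDerivative.torsion_eq_zero_iff]
  intro X Y x hX hY
  apply (g.flat x).injective
  ext w : 1
  have hw := diffAt_extend w
  have h1 := g.val_leviCivita hY hX hw
  have h2 := g.val_leviCivita hX hY hw
  rw [extend_self] at h1 h2
  simp only [map_sub, sub_apply, flat_apply]
  rw [h1, h2]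
  simp only [koszul, g.pair_comm Y X, extend_self]
  rw [mlieBracket_swap_apply (V := Y) (W := X)]
  simp
  ring

/-- `v` is a null vector: it is non-zero and `g(v, v) = 0`. -/
def IsNull (g : LorentzMetric d M) {x : M} (v : TangentSpace (𝓡 d) x) : Prop :=
  v ≠ 0 ∧ g.val x v v = 0

end LorentzMetric

/-! ### Differential forms and the Maxwell equations -/

/-- A (not necessarily smooth) differential form of degree `k` on the manifold `M`. -/
abbrev Form (d : ℕ) (M : Type*) [TopologicalSpace M]
    [ChartedSpace (EuclideanSpace ℝ (Fin d)) M] (k : ℕ) :=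
  Π x : M, TangentSpace (𝓡 d) x [⋀^Fin k]→L[ℝ] ℝ

/-- Smoothness of a differential form, as a section of the bundle of alternating forms. -/
def Form.IsSmooth {k : ℕ} (F : Form d M k) : Prop :=
  ContMDiff (𝓡 d) ((𝓡 d).prod 𝓘(ℝ, EuclideanSpace ℝ (Fin d) [⋀^Fin k]→L[ℝ] ℝ)) ∞
    (fun x ↦ TotalSpace.mk' (EuclideanSpace ℝ (Fin d) [⋀^Fin k]→L[ℝ] ℝ)
      (E := fun x : M ↦ TangentSpace (𝓡 d) x [⋀^Fin k]→L[ℝ] Bundle.Trivial M ℝ x) x (F x))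

/-- Smoothness of a vector field. -/
def IsSmoothField (X : Π x : M, TangentSpace (𝓡 d) x) : Prop :=
  ContMDiff (𝓡 d) ((𝓡 d).prod 𝓘(ℝ, EuclideanSpace ℝ (Fin d))) ∞
    (fun x ↦ TotalSpace.mk' (EuclideanSpace ℝ (Fin d)) x (X x))

/-- The covariant derivative of a form,
`(∇_v F)(w₁, …, w_k) = v (F(W₁, …, W_k)) - ∑ r, F(w₁, …, ∇_v W_r, …, w_k)`,
where `W_r` is a vector field extending the tangent vector `w_r`. -/
def covDeriv (g : LorentzMetric d M) {k : ℕ} (F : Form d M k) (x : M)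
    (v : TangentSpace (𝓡 d) x) (w : Fin k → TangentSpace (𝓡 d) x) : ℝ :=
  mvfderiv (𝓡 d) (fun y ↦ F y (fun r ↦ extend (w r) y)) x v
    - ∑ r, F x (Function.update w r (g.leviCivita (extend (w r)) x v))

/-- The divergence `∇^μ F_{μ ν₁ … ν_k}` of a `(k+1)`-form at `x`, evaluated on `k` tangent
vectors and computed in the basis `b`: `∑ μ ν, g^{μ ν} (∇_{b_μ} F)(b_ν, w₁, …, w_k)` with
`g^{μ ν}` the inverse of the matrix `g(b_μ, b_ν)`. -/
def divergence (g : LorentzMetric d M) {k : ℕ} (F : Form d M (k + 1)) (x : M)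
    (b : Basis (Fin d) ℝ (TangentSpace (𝓡 d) x)) (w : Fin k → TangentSpace (𝓡 d) x) : ℝ :=
  ∑ μ, ∑ ν, (Matrix.of fun α β ↦ g.val x (b α) (b β))⁻¹ μ ν *
    covDeriv g F x (b μ) (Fin.cons (b ν) w)

/-- The antisymmetrized covariant derivative of a `k`-form, normalized as
`∑ r, (-1)^r (∇_{w_r} F)(w₀, …, w_{r-1}, w_{r+1}, …, w_k)`, i.e. `(k+1) ∇_{[ν₀} F_{ν₁ … ν_k]}`. -/
def antisymmDeriv (g : LorentzMetric d M) {k : ℕ} (F : Form d M k) (x : M)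
    (w : Fin (k + 1) → TangentSpace (𝓡 d) x) : ℝ :=
  ∑ r : Fin (k + 1), (-1 : ℝ) ^ (r : ℕ) * covDeriv g F x (w r) (fun s ↦ w (r.succAbove s))

/-- A Maxwell `(p+1)`-form field: a smooth form satisfying the source-free Maxwell equations
`∇^μ F_{μ ν₁ … ν_p} = 0` and `∇_{[ν₁} F_{ν₂ … ν_{p+2}]} = 0`. -/
structure IsMaxwell (g : LorentzMetric d M) {p : ℕ} (F : Form d M (p + 1)) : Prop where
  smooth : F.IsSmooth
  divergence_eq_zero (x : M) (b : Basis (Fin d) ℝ (TangentSpace (𝓡 d) x))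
    (w : Fin p → TangentSpace (𝓡 d) x) : divergence g F x b w = 0
  antisymmDeriv_eq_zero (x : M) (w : Fin (p + 2) → TangentSpace (𝓡 d) x) :
    antisymmDeriv g F x w = 0

/-! ### Null frames and the optical matrix -/

/-- A null frame `ℓ, n, m_i` of the tangent space at `x`: the only non-vanishing scalar products
are `ℓ · n = 1` and `m_i · m_j = δ_ij`. The `d - 2` spatial vectors are labelled by
`Fin (d - 2)`. -/
structure NullFrame (g : LorentzMetric d M) (x : M) where
  ell : TangentSpace (𝓡 d) x
  n : TangentSpace (𝓡 d) x
  m : Fin (d - 2) → TangentSpace (𝓡 d) x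
  ell_ell : g.val x ell ell = 0
  n_n : g.val x n n = 0
  ell_n : g.val x ell n = 1
  ell_m : ∀ i, g.val x ell (m i) = 0
  n_m : ∀ i, g.val x n (m i) = 0
  m_m : ∀ i j, g.val x (m i) (m j) = if i = j then 1 else 0

namespace NullFrame

variable {g : LorentzMetric d M} {x : M}

/-- The frame vectors `e_(0) = ℓ`, `e_(1) = n`, `e_(i) = m_i`, with the frame index `0`, `1` or
`i` written as `Sum.inl 0`, `Sum.inl 1` or `Sum.inr i`. -/
def vec (e : NullFrame g x) : Fin 2 ⊕ Fin (d - 2) → TangentSpace (𝓡 d) x :=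
  Sum.elim ![e.ell, e.n] e.m

/-- The components `κ_i = L_{i0} = m_i · ∇_ℓ ℓ`, where the vector field `l` extends the frame
vector `ℓ`. -/
def kappa (e : NullFrame g x) (l : Π x : M, TangentSpace (𝓡 d) x) (i : Fin (d - 2)) : ℝ :=
  g.val x (e.m i) (g.leviCivita l x e.ell)

/-- The optical matrix `ρ_ij = L_{ij} = m_i · ∇_{m_j} ℓ`. -/
def rho (e : NullFrame g x) (l : Π x : M, TangentSpace (𝓡 d) x) :
    Matrix (Fin (d - 2)) (Fin (d - 2)) ℝ :=
  Matrix.of fun i j ↦ g.val x (e.m i) (g.leviCivita l x (e.m j))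

/-- The symmetric part `ρ_(ij)` of the optical matrix. -/
def rhoSymm (e : NullFrame g x) (l : Π x : M, TangentSpace (𝓡 d) x) :
    Matrix (Fin (d - 2)) (Fin (d - 2)) ℝ :=
  (1 / 2 : ℝ) • (e.rho l + (e.rho l).transpose)

theorem isHermitian_rhoSymm (e : NullFrame g x) (l : Π x : M, TangentSpace (𝓡 d) x) :
    (e.rhoSymm l).IsHermitian := by
  ext i j
  simp only [rhoSymm, Matrix.conjTranspose_apply, Matrix.smul_apply, Matrix.add_apply,
    Matrix.transpose_apply, smul_eq_mul, star_trivial]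
  ring

end NullFrame

/-- The boost weight of the component `F_{a₁ … a_k}` in a null frame: the number of indices `0`
minus the number of indices `1`. -/
def boostWeight {d k : ℕ} (a : Fin k → Fin 2 ⊕ Fin (d - 2)) : ℤ :=
  ((Finset.univ.filter fun r ↦ a r = Sum.inl 0).card : ℤ)
    - ((Finset.univ.filter fun r ↦ a r = Sum.inl 1).card : ℤ)

/-- The vector field `l` is multiply aligned with `F`: at every point, in a null frame containing
`l`, all components of `F` of non-negative boost weight vanish. (This does not depend on the
choice of the other frame vectors.) -/
def IsMultiplyAligned (g : LorentzMetric d M) {k : ℕ} (F : Form d M k)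
    (l : Π x : M, TangentSpace (𝓡 d) x) : Prop :=
  ∀ x, ∃ e : NullFrame g x, e.ell = l x ∧
    ∀ a : Fin k → Fin 2 ⊕ Fin (d - 2), 0 ≤ boostWeight a → F x (fun r ↦ e.vec (a r)) = 0

end Spacetime

end

namespace Spacetime

/-! Multiple alignment says that `F` is killed by contraction with ℓ and vanishes on the hyperplane
orthogonal to ℓ (`apply_eq_zero_of_mem`, `apply_eq_zero_of_orthogonal`). All that remains of `F` is
the array φ = F(n, m, …, m). Both conditions hold identically on M, so differentiating them
expresses many components of ∇F algebraically through ∇ℓ and `F` (`covDeriv_of_apply_eq_zero`,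
`covDeriv_of_orthogonal`).

Contracting dF = 0 with ℓ says that the Lie derivative of `F` along ℓ vanishes
(`covDeriv_add_sum_eq_zero`).

For (i), put K = ∇_ℓ ℓ, which is orthogonal to ℓ. The divergence equation with ℓ among its arguments
gives F(n, …, K, …) = 0; the Lie derivative evaluated on (K, m, …, m) then reduces to g(K, K) φ = 0.
With φ ≠ 0 the vector K satisfies g(K, K) = 0, and a vector orthogonal to ℓ with this property is a
multiple of ℓ.

For (ii), the Lie derivative equation and the divergence equation both determine (∇_ℓ F)(n, m, …,
m). Eliminating it leaves ρ φ = 2 S·φ, where S· is the derivation induced by the symmetric part of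
the optical matrix (`trace_rho_mul_eq`). In a frame that diagonalizes this part, S· multiplies φ_I
by the sum of the eigenvalues indexed by I. Any I with φ_I ≠ 0 therefore selects p eigenvalues with
sum ρ/2. -/

theorem update_field_apply {ι N : Type*} {E : N → Type*} [DecidableEq ι] (W : ι → Π y, E y)
    (r : ι) (X : Π y, E y) (y : N) :
    (fun s ↦ Function.update W r X s y) = Function.update (fun s ↦ W s y) r (X y) := by
  funext s
  by_cases h : s = r
  · subst h; simp
  · simp [h]

variable {d : ℕ} {M : Type*} [TopologicalSpace M]
  [ChartedSpace (EuclideanSpace ℝ (Fin d)) M] [IsManifold (𝓡 d) ∞ M]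

/-! ### The covariant derivative of a form along arbitrary vector fields -/

/-- In the trivialization at x, the function is the evaluation of a differentiable alternating map
on differentiable vectors, and evaluation is differentiable in both. -/
theorem Form.IsSmooth.mdifferentiableAt_apply {k : ℕ} {F : Form d M k} (hF : F.IsSmooth) {x : M}
    {W : Fin k → Π y : M, TangentSpace (𝓡 d) y} (hW : ∀ r, DiffAt (W r) x) :
    MDifferentiableAt (𝓡 d) 𝓘(ℝ, ℝ) (fun y ↦ F y (fun r ↦ W r y)) x := by
  have h1 := ((hF x).mdifferentiableAt (by simp))
  rw [mdifferentiableAt_totalSpace] at h1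
  have h2 := h1.2
  have h3 : ∀ r, MDifferentiableAt (𝓡 d) 𝓘(ℝ, EuclideanSpace ℝ (Fin d))
      (fun y ↦ (trivializationAt (EuclideanSpace ℝ (Fin d)) (fun x : M ↦ TangentSpace (𝓡 d) x) x
        (TotalSpace.mk' (EuclideanSpace ℝ (Fin d)) y (W r y))).2) x := fun r ↦
    (mdifferentiableAt_section (𝓡 d) (W r)).1 (hW r)
  have h4 : MDifferentiableAt (𝓡 d) 𝓘(ℝ, Fin k → EuclideanSpace ℝ (Fin d))
      (fun y r ↦ (trivializationAt (EuclideanSpace ℝ (Fin d)) (fun x : M ↦ TangentSpace (𝓡 d) x) x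
        (TotalSpace.mk' (EuclideanSpace ℝ (Fin d)) y (W r y))).2) x :=
    (mdifferentiableAt_iff _ _).2 ⟨continuousAt_pi.2 fun r ↦ (h3 r).continuousAt,
      differentiableWithinAt_pi.2 fun r ↦ (h3 r).differentiableWithinAt_writtenInExtChartAt⟩
  have h5 := h2.prodMk_space h4
  have h6 : Differentiable ℝ (fun q : (EuclideanSpace ℝ (Fin d) [⋀^Fin k]→L[ℝ] ℝ) ×
      (Fin k → EuclideanSpace ℝ (Fin d)) ↦ q.1 q.2) := fun q ↦
    (differentiableAt_fst (𝕜 := ℝ)).continuousAlternatingMap_apply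
      fun i ↦ differentiableAt_pi.1 (differentiableAt_snd (𝕜 := ℝ) (p := q)) i
  refine (h6.comp_mdifferentiableAt h5).congr_of_eventuallyEq ?_
  filter_upwards [(trivializationAt (EuclideanSpace ℝ (Fin d))
    (fun x : M ↦ TangentSpace (𝓡 d) x) x).open_baseSet.mem_nhds
    (FiberBundle.mem_baseSet_trivializationAt' x)] with y hy
  have h7 : ∀ r, (trivializationAt (EuclideanSpace ℝ (Fin d)) (fun x : M ↦ TangentSpace (𝓡 d) x)
      x).symmL ℝ y (trivializationAt (EuclideanSpace ℝ (Fin d))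
        (fun x : M ↦ TangentSpace (𝓡 d) x) x
        (TotalSpace.mk' (EuclideanSpace ℝ (Fin d)) y (W r y))).2 = W r y := fun r ↦ by
    have h := Trivialization.symmL_continuousLinearMapAt (R := ℝ) _ hy (W r y)
    rwa [Trivialization.continuousLinearMapAt_apply_of_mem (R := ℝ) (hb := hy)] at h
  have h8 : (trivializationAt (EuclideanSpace ℝ (Fin d) [⋀^Fin k]→L[ℝ] ℝ)
      (fun x ↦ TangentSpace (𝓡 d) x [⋀^Fin k]→L[ℝ] Trivial M ℝ x) x ⟨y, F y⟩).2
      = (F y).compContinuousLinearMap ((trivializationAt (EuclideanSpace ℝ (Fin d))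
        (fun x : M ↦ TangentSpace (𝓡 d) x) x).symmL ℝ y) := by
    rw [FiberBundle.trivializationAt_continuousAlternatingMap_apply]
    ext u
    simp only [ContinuousAlternatingMap.inCoordinates]
    simp
  simp only [Function.comp_apply]
  rw [h8]
  change F y (fun r ↦ W r y) = F y (fun r ↦ _)
  exact congrArg (F y) (funext fun r ↦ (h7 r).symm)

theorem Form.IsSmooth.tensorialAt {k : ℕ} {F : Form d M k} (hF : F.IsSmooth)
    (g : LorentzMetric d M) {x : M} (v : TangentSpace (𝓡 d) x)
    {W : Fin k → Π y : M, TangentSpace (𝓡 d) y} (hW : ∀ r, DiffAt (W r) x) (r : Fin k) :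
    TensorialAt (𝓡 d) (EuclideanSpace ℝ (Fin d)) (fun X ↦
      mvfderiv (𝓡 d) (fun y ↦ F y (fun s ↦ Function.update W r X s y)) x v
        - ∑ s, F x (Function.update (fun q ↦ Function.update W r X q x) s
            (g.leviCivita (Function.update W r X s) x v))) x := by
  have hdiff : ∀ {X : Π y : M, TangentSpace (𝓡 d) y}, DiffAt X x →
      MDifferentiableAt (𝓡 d) 𝓘(ℝ, ℝ)
        (fun y ↦ F y (Function.update (fun s ↦ W s y) r (X y))) x := by
    intro X hX
    simp only [← update_field_apply]
    refine hF.mdifferentiableAt_apply fun s ↦ ?_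
    by_cases h : s = r
    · subst h; simpa using hX
    · simpa [h] using hW s
  have hcov := g.leviCivita.isCovariantDerivativeOnUniv
  simp only [update_field_apply]
  constructor
  · intro f X hf hX
    have h1 : (fun y ↦ F y (Function.update (fun s ↦ W s y) r ((f • X) y)))
        = f * fun y ↦ F y (Function.update (fun s ↦ W s y) r (X y)) := by
      funext y
      simp
    -- Only the term s = r sees the derivative of f; its extra contribution cancels the Leibniz term
    -- of the product f · F(…).
    have h2 : ∀ s, F x (Function.update (Function.update (fun s ↦ W s x) r ((f • X) x)) s
        (g.leviCivita (Function.update W r (f • X) s) x v))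
        = f x * F x (Function.update (Function.update (fun s ↦ W s x) r (X x)) s
        (g.leviCivita (Function.update W r X s) x v)) + if s = r then
          mvfderiv (𝓡 d) f x v * F x (Function.update (fun s ↦ W s x) r (X x)) else 0 := by
      intro s
      by_cases h : s = r
      · subst h
        have h3 := congrArg (fun T ↦ T v) (hcov.leibniz hX hf (Set.mem_univ x))
        simp only [Function.update_self, Function.update_idem, if_true]
        rw [h3]
        simp
      · simp [h, Function.update_comm (Ne.symm h)]
    rw [h1, mvfderiv_mul hf (hdiff hX), Finset.sum_congr rfl fun s _ ↦ h2 s,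
      Finset.sum_add_distrib, ← Finset.mul_sum]
    simp
    ring
  · intro X X' hX hX'
    have h1 : (fun y ↦ F y (Function.update (fun s ↦ W s y) r ((X + X') y)))
        = (fun y ↦ F y (Function.update (fun s ↦ W s y) r (X y)))
          + fun y ↦ F y (Function.update (fun s ↦ W s y) r (X' y)) := by
      funext y
      simp
    have h2 : ∀ s, F x (Function.update (Function.update (fun s ↦ W s x) r ((X + X') x)) s
        (g.leviCivita (Function.update W r (X + X') s) x v))
        = F x (Function.update (Function.update (fun s ↦ W s x) r (X x)) s
        (g.leviCivita (Function.update W r X s) x v))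
        + F x (Function.update (Function.update (fun s ↦ W s x) r (X' x)) s
        (g.leviCivita (Function.update W r X' s) x v)) := by
      intro s
      by_cases h : s = r
      · subst h
        have h3 := congrArg (fun T ↦ T v) (hcov.add hX hX' (Set.mem_univ x))
        simp only [Function.update_self, Function.update_idem]
        rw [h3]
        simp
      · simp [h, Function.update_comm (Ne.symm h)]
    rw [h1, mvfderiv_add (hdiff hX) (hdiff hX'), Finset.sum_congr rfl fun s _ ↦ h2 s,
      Finset.sum_add_distrib]
    simp
    ring

/-- The covariant derivative of a smooth form may be computed with arbitrary vector fields
extending the given tangent vectors. -/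
theorem Form.IsSmooth.covDeriv_eq {k : ℕ} {F : Form d M k} (hF : F.IsSmooth)
    (g : LorentzMetric d M) {x : M} (v : TangentSpace (𝓡 d) x)
    {W : Fin k → Π y : M, TangentSpace (𝓡 d) y} (hW : ∀ r, DiffAt (W r) x) :
    covDeriv g F x v (fun r ↦ W r x)
      = mvfderiv (𝓡 d) (fun y ↦ F y (fun s ↦ W s y)) x v
        - ∑ s, F x (Function.update (fun q ↦ W q x) s (g.leviCivita (W s) x v)) := by
  classical
  let Φ (V : Fin k → Π y : M, TangentSpace (𝓡 d) y) : ℝ :=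
    mvfderiv (𝓡 d) (fun y ↦ F y (fun s ↦ V s y)) x v
        - ∑ s, F x (Function.update (fun q ↦ V q x) s (g.leviCivita (V s) x v))
  -- V S interpolates between the constant-component extensions (S = ∅) and W (S everything).
  -- Enlarging S changes one slot at a time, and tensoriality in that slot keeps Φ fixed.
  let V (S : Finset (Fin k)) (r : Fin k) : Π y : M, TangentSpace (𝓡 d) y :=
    if r ∈ S then W r else extend (W r x)
  have hV : ∀ S r, DiffAt (V S r) x := by
    intro S r
    by_cases h : r ∈ S
    · simpa [V, h] using hW r
    · simpa [V, h] using diffAt_extend (W r x)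
  have key : ∀ S, Φ (V S) = Φ (V ∅) := by
    intro S
    induction S using Finset.induction_on with
    | empty => rfl
    | insert r S hr ih =>
      rw [← ih]
      have h1 : V (insert r S) = Function.update (V S) r (W r) := by
        funext s
        by_cases h : s = r
        · subst h; simp [V]
        · simp [V, h]
      have h2 : V S = Function.update (V S) r (extend (W r x)) := by
        funext s
        by_cases h : s = r
        · subst h; simp [V, hr]
        · simp [h]
      rw [h1]
      conv_rhs => rw [h2]
      exact (hF.tensorialAt g v (hV S) r).pointwise (hW r) (diffAt_extend _) (extend_self _).symm
  have h3 := key Finset.univ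
  have h4 : V Finset.univ = W := by funext r; simp [V]
  have h5 : V ∅ = fun r ↦ extend (W r x) := by funext r; simp [V]
  rw [h4, h5] at h3
  change _ = Φ W
  rw [h3]
  simp only [Φ, covDeriv, extend_self]

/-! ### Algebra of null frames -/

namespace NullFrame

variable {g : LorentzMetric d M} {x : M}

/-- The index of the frame vector dual to a given one: `ℓ` and `n` are dual to each other, and
each `m_i` is dual to itself. -/
def dual (d : ℕ) : Equiv.Perm (Fin 2 ⊕ Fin (d - 2)) :=
  Equiv.sumCongr (Equiv.swap 0 1) (Equiv.refl _)

theorem dual_dual (a : Fin 2 ⊕ Fin (d - 2)) : dual d (dual d a) = a := by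
  rcases a with a | a <;> simp [dual]

@[simp] theorem dual_inl_zero : dual d (Sum.inl 0) = Sum.inl 1 := by simp [dual]

@[simp] theorem dual_inl_one : dual d (Sum.inl 1) = Sum.inl 0 := by simp [dual]

@[simp] theorem dual_inr (i : Fin (d - 2)) : dual d (Sum.inr i) = Sum.inr i := rfl

@[simp] theorem vec_inl_zero (e : NullFrame g x) : e.vec (Sum.inl 0) = e.ell := rfl

@[simp] theorem vec_inl_one (e : NullFrame g x) : e.vec (Sum.inl 1) = e.n := rfl

@[simp] theorem vec_inr (e : NullFrame g x) (i : Fin (d - 2)) : e.vec (Sum.inr i) = e.m i := rfl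

theorem n_ell (e : NullFrame g x) : g.val x e.n e.ell = 1 := by rw [g.symm, e.ell_n]

theorem m_ell (e : NullFrame g x) (i : Fin (d - 2)) : g.val x (e.m i) e.ell = 0 := by
  rw [g.symm, e.ell_m]

theorem m_n (e : NullFrame g x) (i : Fin (d - 2)) : g.val x (e.m i) e.n = 0 := by
  rw [g.symm, e.n_m]

theorem val_vec (e : NullFrame g x) (a b : Fin 2 ⊕ Fin (d - 2)) :
    g.val x (e.vec a) (e.vec b) = if b = dual d a then 1 else 0 := by
  rcases a with a | a <;> rcases b with b | b
  · fin_cases a <;> fin_cases b <;> simp [e.ell_ell, e.ell_n, e.n_ell, e.n_n]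
  · fin_cases a <;> simp [e.ell_m, e.n_m]
  · fin_cases b <;> simp [e.m_ell, e.m_n]
  · simp [e.m_m, eq_comm]

theorem val_vec_dual (e : NullFrame g x) (a b : Fin 2 ⊕ Fin (d - 2)) :
    g.val x (e.vec (dual d a)) (e.vec b) = if b = a then 1 else 0 := by
  rw [val_vec, dual_dual]

theorem linearIndependent_vec (e : NullFrame g x) : LinearIndependent ℝ e.vec := by
  rw [Fintype.linearIndependent_iff]
  intro c hc a
  have h := congrArg (g.val x (e.vec (dual d a))) hc
  simpa [map_sum, val_vec_dual, -Fintype.sum_sum_type] using h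

/-- The basis of the tangent space consisting of the vectors of a null frame. -/
noncomputable def basis (hd : 2 ≤ d) (e : NullFrame g x) :
    Basis (Fin 2 ⊕ Fin (d - 2)) ℝ (TangentSpace (𝓡 d) x) :=
  haveI : FiniteDimensional ℝ (TangentSpace (𝓡 d) x) :=
    inferInstanceAs (FiniteDimensional ℝ (EuclideanSpace ℝ (Fin d)))
  haveI : Nonempty (Fin 2 ⊕ Fin (d - 2)) := ⟨Sum.inl 0⟩
  basisOfLinearIndependentOfCardEqFinrank e.linearIndependent_vec (by
    have h : finrank ℝ (TangentSpace (𝓡 d) x) = d :=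
      finrank_euclideanSpace_fin (𝕜 := ℝ) (n := d)
    rw [h]
    simp
    omega)

@[simp] theorem basis_apply (hd : 2 ≤ d) (e : NullFrame g x) (a : Fin 2 ⊕ Fin (d - 2)) :
    e.basis hd a = e.vec a := by
  simp [basis]

theorem sum_val_smul_vec (hd : 2 ≤ d) (e : NullFrame g x) (v : TangentSpace (𝓡 d) x) :
    ∑ a, g.val x (e.vec (dual d a)) v • e.vec a = v := by
  have h : ∀ a, g.val x (e.vec (dual d a)) v = (e.basis hd).repr v a := by
    intro a
    conv_lhs => rw [← (e.basis hd).sum_repr v]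
    simp [map_sum, val_vec_dual, -Fintype.sum_sum_type]
  simp only [h]
  simpa using (e.basis hd).sum_repr v

theorem eq_sum (hd : 2 ≤ d) (e : NullFrame g x) (v : TangentSpace (𝓡 d) x) :
    v = g.val x e.n v • e.ell + g.val x e.ell v • e.n + ∑ i, g.val x (e.m i) v • e.m i := by
  conv_lhs => rw [← e.sum_val_smul_vec hd v]
  simp

/-- The divergence computed in a null frame. -/
theorem divergence_eq (hd : 2 ≤ d) (e : NullFrame g x) {k : ℕ} {F : Form d M (k + 1)}
    {w : Fin k → TangentSpace (𝓡 d) x}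
    (h : ∀ b : Basis (Fin d) ℝ (TangentSpace (𝓡 d) x), divergence g F x b w = 0) :
    covDeriv g F x e.ell (Fin.cons e.n w) + covDeriv g F x e.n (Fin.cons e.ell w)
      + ∑ i, covDeriv g F x (e.m i) (Fin.cons (e.m i) w) = 0 := by
  have hc : Fintype.card (Fin 2 ⊕ Fin (d - 2)) = Fintype.card (Fin d) := by simp; omega
  let σ : Fin 2 ⊕ Fin (d - 2) ≃ Fin d := Fintype.equivOfCardEq hc
  let G : Matrix (Fin 2 ⊕ Fin (d - 2)) (Fin 2 ⊕ Fin (d - 2)) ℝ :=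
    Matrix.of fun a b ↦ if b = dual d a then 1 else 0
  -- The Gram matrix of a null frame is the permutation matrix of the involution `dual`, hence its
  -- own inverse.
  have hG : G⁻¹ = G := by
    refine Matrix.inv_eq_right_inv ?_
    ext a b
    rw [Matrix.mul_apply, Finset.sum_eq_single (dual d a)]
    · simp [G, Matrix.one_apply, dual_dual, @eq_comm _ b a]
    · intro c _ hc
      simp [G, hc]
    · simp
  have h1 := h ((e.basis hd).reindex σ)
  have h2 : (Matrix.of fun α β ↦ g.val x ((e.basis hd).reindex σ α) ((e.basis hd).reindex σ β))
      = G.submatrix σ.symm σ.symm := by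
    ext α β
    simp [G, val_vec]
  have h3 : ∑ a, covDeriv g F x (e.vec a) (Fin.cons (e.vec (dual d a)) w) = 0 := by
    rw [← h1, divergence, h2, Matrix.inv_submatrix_equiv, hG]
    refine Fintype.sum_equiv σ _ _ fun a ↦ ?_
    rw [← Equiv.sum_comp σ]
    simp [G, -Fintype.sum_sum_type]
  simpa [Fin.sum_univ_two] using h3

end NullFrame

/-! ### Forms with a multiply aligned null vector -/

theorem IsMultiplyAligned.apply_eq_zero_of_mem (hd : 2 ≤ d) {g : LorentzMetric d M} {k : ℕ}
    {F : Form d M k} {l : Π x : M, TangentSpace (𝓡 d) x} (h : IsMultiplyAligned g F l) (x : M)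
    {w : Fin k → TangentSpace (𝓡 d) x} (r : Fin k) (hw : w r = l x) : F x w = 0 := by
  obtain ⟨e, he, h0⟩ := h x
  have hexp : w = fun r ↦ ∑ a, g.val x (e.vec (NullFrame.dual d a)) (w r) • e.vec a :=
    funext fun r ↦ (e.sum_val_smul_vec hd (w r)).symm
  rw [hexp, (F x).map_sum]
  refine Finset.sum_eq_zero fun a _ ↦ ?_
  rw [(F x).map_smul_univ]
  by_cases h1 : a r = Sum.inl 0
  · refine smul_eq_zero_of_right _ ?_
    -- The boost weight is non-negative once ℓ occurs and n occurs at most once; a repeated n is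
    -- killed by antisymmetry instead.
    by_cases h2 : ∃ s t, s ≠ t ∧ a s = Sum.inl 1 ∧ a t = Sum.inl 1
    · obtain ⟨s, t, hst, hs, ht⟩ := h2
      exact (F x).map_eq_zero_of_eq _ (by rw [hs, ht]) hst
    · refine h0 a ?_
      have h3 : (Finset.univ.filter fun r ↦ a r = Sum.inl 1).card ≤ 1 := by
        rw [Finset.card_le_one]
        intro s hs t ht
        by_contra hst
        exact h2 ⟨s, t, hst, by simpa using hs, by simpa using ht⟩
      have h4 : 0 < (Finset.univ.filter fun r ↦ a r = Sum.inl 0).card :=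
        Finset.card_pos.2 ⟨r, by simpa using h1⟩
      simp only [boostWeight]
      omega
  · refine smul_eq_zero_of_left (Finset.prod_eq_zero (Finset.mem_univ r) ?_) _
    rw [hw, ← he, ← e.vec_inl_zero, e.val_vec_dual, if_neg (Ne.symm h1)]

/-- Vectors orthogonal to ℓ have no n-component, so only components without the index 1 survive, and
their boost weight is non-negative. -/
theorem IsMultiplyAligned.apply_eq_zero_of_orthogonal (hd : 2 ≤ d) {g : LorentzMetric d M} {k : ℕ}
    {F : Form d M k} {l : Π x : M, TangentSpace (𝓡 d) x} (h : IsMultiplyAligned g F l) (x : M)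
    {w : Fin k → TangentSpace (𝓡 d) x} (hw : ∀ r, g.val x (l x) (w r) = 0) : F x w = 0 := by
  obtain ⟨e, he, h0⟩ := h x
  have hexp : w = fun r ↦ ∑ a, g.val x (e.vec (NullFrame.dual d a)) (w r) • e.vec a :=
    funext fun r ↦ (e.sum_val_smul_vec hd (w r)).symm
  rw [hexp, (F x).map_sum]
  refine Finset.sum_eq_zero fun a _ ↦ ?_
  rw [(F x).map_smul_univ]
  by_cases h1 : ∃ r, a r = Sum.inl 1
  · obtain ⟨r, hr⟩ := h1
    refine smul_eq_zero_of_left (Finset.prod_eq_zero (Finset.mem_univ r) ?_) _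
    rw [hr, NullFrame.dual_inl_one, e.vec_inl_zero, he, hw]
  · refine smul_eq_zero_of_right _ (h0 a ?_)
    have h2 : (Finset.univ.filter fun r ↦ a r = Sum.inl 1) = ∅ :=
      Finset.filter_eq_empty_iff.2 fun r _ hr ↦ h1 ⟨r, hr⟩
    simp [boostWeight, h2]

/-- A non-vanishing form with a multiply aligned null vector has a non-vanishing component of
boost weight `-1`. -/
theorem IsMultiplyAligned.exists_apply_ne_zero (hd : 2 ≤ d) {g : LorentzMetric d M} {p : ℕ}
    {F : Form d M (p + 1)} {l : Π x : M, TangentSpace (𝓡 d) x} (h : IsMultiplyAligned g F l)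
    {x : M} (hx : F x ≠ 0) (e : NullFrame g x) (he : e.ell = l x) :
    ∃ I : Fin p → Fin (d - 2), Function.Injective I ∧
      F x (Fin.cons e.n fun j ↦ e.m (I j)) ≠ 0 := by
  have h1 : ∃ a : Fin (p + 1) → Fin 2 ⊕ Fin (d - 2), Function.Injective a ∧
      F x (fun r ↦ e.vec (a r)) ≠ 0 := by
    by_contra! h2
    refine hx (ContinuousAlternatingMap.toAlternatingMap_injective
      ((e.basis hd).ext_alternating fun a ha ↦ ?_))
    simpa using h2 a ha
  obtain ⟨a, ha, hFa⟩ := h1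
  have h3 : ∀ r, a r ≠ Sum.inl 0 := fun r hr ↦
    hFa (h.apply_eq_zero_of_mem hd x r (by simp [hr, he]))
  obtain ⟨r, hr⟩ : ∃ r, a r = Sum.inl 1 := by
    by_contra! h4
    refine hFa (h.apply_eq_zero_of_orthogonal hd x fun r ↦ ?_)
    rw [← he, ← e.vec_inl_zero, e.val_vec, if_neg]
    simpa using h4 r
  -- By injectivity n sits in slot r alone; the transposition brings it to the front and leaves only
  -- spatial vectors behind it.
  have h5 : ∀ j : Fin p, ∃ i, a (Equiv.swap 0 r j.succ) = Sum.inr i := by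
    intro j
    rcases hj : a (Equiv.swap 0 r j.succ) with b | i
    · fin_cases b
      · exact absurd hj (h3 _)
      · have := ha (hj.trans hr.symm)
        rw [Equiv.swap_apply_eq_iff, Equiv.swap_apply_right] at this
        exact absurd this (Fin.succ_ne_zero j)
    · exact ⟨i, rfl⟩
  choose I hI using h5
  have h6 : (Fin.cons e.n fun j ↦ e.m (I j) : Fin (p + 1) → TangentSpace (𝓡 d) x)
      = (fun r ↦ e.vec (a r)) ∘ Equiv.swap 0 r := by
    funext s
    refine Fin.cases ?_ (fun j ↦ ?_) s
    · simp [hr]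
    · simp [hI]
  refine ⟨I, fun i j hij ↦ ?_, ?_⟩
  · have := ha ((hI i).trans ((congrArg Sum.inr hij).trans (hI j).symm))
    simpa using this
  · rw [h6]
    have h7 := (F x).toAlternatingMap.map_perm (fun r ↦ e.vec (a r)) (Equiv.swap 0 r)
    simp only [ContinuousAlternatingMap.coe_toAlternatingMap] at h7
    rw [h7]
    rcases Int.units_eq_one_or (Equiv.Perm.sign (Equiv.swap 0 r)) with h8 | h8 <;>
      simpa [h8] using hFa

/-! ### First derivatives of an aligned form -/

theorem IsSmoothField.diffAt {l : Π x : M, TangentSpace (𝓡 d) x} (hl : IsSmoothField l) (x : M) :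
    DiffAt l x :=
  (hl x).mdifferentiableAt (by simp)

theorem LorentzMetric.val_leviCivita_self (g : LorentzMetric d M)
    {l : Π x : M, TangentSpace (𝓡 d) x} (hl : IsSmoothField l) (h0 : ∀ x, g.val x (l x) (l x) = 0)
    (x : M) (v : TangentSpace (𝓡 d) x) : g.val x (l x) (g.leviCivita l x v) = 0 := by
  have h := g.leviCivita_metric (hl.diffAt x) (hl.diffAt x) v
  have h1 : (fun y ↦ g.val y (l y) (l y)) = fun _ ↦ (0 : ℝ) := funext h0
  rw [h1, mvfderiv_const, g.symm x _ (l x)] at h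
  simp at h
  linarith

/-- Extending slot r by `l` itself makes F(W) vanish identically, and every correction term still
containing ℓ vanishes too. -/
theorem covDeriv_of_apply_eq_zero {g : LorentzMetric d M} {k : ℕ}
    {F : Form d M k} (hF : F.IsSmooth) {l : Π x : M, TangentSpace (𝓡 d) x} (hl : IsSmoothField l)
    (hmem : ∀ (y : M) (w : Fin k → TangentSpace (𝓡 d) y) (r : Fin k), w r = l y → F y w = 0)
    {x : M} (v : TangentSpace (𝓡 d) x) (w : Fin k → TangentSpace (𝓡 d) x) (r : Fin k)
    (hw : w r = l x) :
    covDeriv g F x v w = -F x (Function.update w r (g.leviCivita l x v)) := by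
  let W : Fin k → Π y : M, TangentSpace (𝓡 d) y :=
    Function.update (fun s ↦ extend (w s)) r l
  have hW : ∀ s, DiffAt (W s) x := by
    intro s
    by_cases h : s = r
    · subst h; simpa [W] using hl.diffAt x
    · simpa [W, h] using diffAt_extend (w s)
  have hWx : (fun s ↦ W s x) = w := by
    funext s
    by_cases h : s = r
    · subst h; simp [W, hw]
    · simp [W, h]
  have h1 := hF.covDeriv_eq g v hW
  have h2 : (fun y ↦ F y fun s ↦ W s y) = fun _ ↦ (0 : ℝ) :=
    funext fun y ↦ hmem y _ r (by simp [W])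
  rw [hWx, h2, mvfderiv_const, Finset.sum_eq_single r] at h1
  · simpa [W] using h1
  · intro s _ hs
    exact hmem x _ r (by simp [Ne.symm hs, hw])
  · simp

/-- Replacing u by u − g(ℓ, u) n makes all arguments orthogonal to ℓ. -/
theorem apply_update_eq_of_orthogonal {g : LorentzMetric d M} {k : ℕ}
    {F : Form d M k} {l : Π x : M, TangentSpace (𝓡 d) x}
    (horth : ∀ (y : M) (w : Fin k → TangentSpace (𝓡 d) y),
      (∀ r, g.val y (l y) (w r) = 0) → F y w = 0)
    {x : M} {n : TangentSpace (𝓡 d) x} (hn : g.val x (l x) n = 1)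
    {w : Fin k → TangentSpace (𝓡 d) x} (hw : ∀ r, g.val x (l x) (w r) = 0) (r : Fin k)
    (u : TangentSpace (𝓡 d) x) :
    F x (Function.update w r u) = g.val x (l x) u * F x (Function.update w r n) := by
  have h := horth x (Function.update w r (u - g.val x (l x) u • n)) (by
    intro s
    by_cases h : s = r
    · subst h; simp [hn]
    · simpa [h] using hw s)
  rw [ContinuousAlternatingMap.map_update_sub, ContinuousAlternatingMap.map_update_smul,
    smul_eq_mul] at h
  linarith

theorem covDeriv_of_orthogonal {g : LorentzMetric d M} {k : ℕ}
    {F : Form d M k} (hF : F.IsSmooth) {l : Π x : M, TangentSpace (𝓡 d) x} (hl : IsSmoothField l)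
    (horth : ∀ (y : M) (w : Fin k → TangentSpace (𝓡 d) y),
      (∀ r, g.val y (l y) (w r) = 0) → F y w = 0)
    {x : M} {n : TangentSpace (𝓡 d) x} (hn : g.val x (l x) n = 1)
    {w : Fin k → TangentSpace (𝓡 d) x} (hw : ∀ r, g.val x (l x) (w r) = 0)
    (v : TangentSpace (𝓡 d) x) :
    covDeriv g F x v w
      = ∑ r, g.val x (g.leviCivita l x v) (w r) * F x (Function.update w r n) := by
  -- The field g(l, n) w_s − g(l, w_s) n is orthogonal to `l` everywhere and equals w_s at x, with
  -- no division by g(l, n).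
  let W : Fin k → Π y : M, TangentSpace (𝓡 d) y := fun s ↦
    g.pair l (extend n) • extend (w s) + (- g.pair l (extend (w s))) • extend n
  have hlx := hl.diffAt x
  have hW : ∀ s, DiffAt (W s) x := fun s ↦
    mdifferentiableAt_add_section
      ((g.mdifferentiableAt_pair hlx (diffAt_extend n)).smul_section (diffAt_extend (w s)))
      ((g.mdifferentiableAt_pair hlx (diffAt_extend (w s))).neg.smul_section (diffAt_extend n))
  have hWx : ∀ s, W s x = w s := by
    intro s
    simp [W, LorentzMetric.pair, hn, hw]
  have hWl : ∀ s y, g.val y (l y) (W s y) = 0 := by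
    intro s y
    simp [W, LorentzMetric.pair]
    ring
  have h1 := hF.covDeriv_eq g v hW
  have h2 : (fun y ↦ F y fun s ↦ W s y) = fun _ ↦ (0 : ℝ) :=
    funext fun y ↦ horth y _ fun s ↦ hWl s y
  simp only [hWx] at h1
  rw [h1, h2, mvfderiv_const, zero_apply, zero_sub, ← Finset.sum_neg_distrib]
  refine Finset.sum_congr rfl fun s _ ↦ ?_
  have h3 := g.leviCivita_metric hlx (hW s) v
  have h4 : (fun y ↦ g.val y (l y) (W s y)) = fun _ ↦ (0 : ℝ) := funext (hWl s)
  rw [h4, mvfderiv_const, hWx] at h3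
  simp only [zero_apply] at h3
  rw [apply_update_eq_of_orthogonal horth hn hw]
  linear_combination F x (Function.update w s n) * h3

theorem apply_cons_succAbove {E : Type*} [AddCommGroup E] [Module ℝ E] [TopologicalSpace E] {k : ℕ}
    (f : E [⋀^Fin (k + 1)]→L[ℝ] ℝ) (z : Fin (k + 1) → E) (i : Fin (k + 1)) (u : E) :
    f (Fin.cons u fun s ↦ z (i.succAbove s)) = (-1) ^ (i : ℕ) * f (Function.update z i u) := by
  have h := f.toAlternatingMap.neg_one_pow_smul_map_insertNth i u (i.removeNth z)
  rw [Fin.insertNth_removeNth] at h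
  have h1 : f (Matrix.vecCons u (i.removeNth z)) = (-1) ^ (i : ℕ) * f (Function.update z i u) := by
    simpa using h.symm
  exact h1

/-- The equation `dF = 0` contracted with the vector field `l`: the Lie derivative of `F` along
`l` vanishes. -/
theorem covDeriv_add_sum_eq_zero {g : LorentzMetric d M} {k : ℕ}
    {F : Form d M (k + 1)} (hF : F.IsSmooth) {l : Π x : M, TangentSpace (𝓡 d) x}
    (hl : IsSmoothField l)
    (hmem : ∀ (y : M) (w : Fin (k + 1) → TangentSpace (𝓡 d) y) (r : Fin (k + 1)),
      w r = l y → F y w = 0)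
    {x : M} (z : Fin (k + 1) → TangentSpace (𝓡 d) x)
    (hd : antisymmDeriv g F x (Fin.cons (l x) z) = 0) :
    covDeriv g F x (l x) z + ∑ i, F x (Function.update z i (g.leviCivita l x (z i))) = 0 := by
  rw [antisymmDeriv, Fin.sum_univ_succ] at hd
  rw [← hd]
  congr 1
  · simp
  · refine Finset.sum_congr rfl fun i _ ↦ ?_
    have h1 : (fun s ↦ (Fin.cons (l x) z : Fin (k + 2) → TangentSpace (𝓡 d) x)
        (i.succ.succAbove s)) = Fin.cons (l x) fun s ↦ z (i.succAbove s) := by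
      funext s
      refine Fin.cases ?_ (fun j ↦ ?_) s
      · simp
      · simp
    -- The remaining form still has ℓ in slot 0, so the derivative falls on ℓ. The sign from moving
    -- the new entry back to slot i cancels that of the antisymmetrization.
    rw [h1, Fin.cons_succ, covDeriv_of_apply_eq_zero hF hl hmem _ _ 0 (by simp),
      Fin.update_cons_zero, apply_cons_succAbove, Fin.val_succ, pow_succ]
    have h2 : ((-1 : ℝ) ^ (i : ℕ)) * (-1) ^ (i : ℕ) = 1 := by
      rw [← mul_pow]; simp
    linear_combination (-F x (Function.update z i (g.leviCivita l x (z i)))) * h2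

/-- Exchanging the entries `u` and `n` of the arguments of an alternating form. -/
theorem apply_cons_update_swap {E : Type*} [AddCommGroup E] [Module ℝ E] [TopologicalSpace E]
    {k : ℕ} (f : E [⋀^Fin (k + 1)]→L[ℝ] ℝ) (w : Fin k → E) (j : Fin k) (u n : E) :
    f (Fin.cons u (Function.update w j n)) = -f (Fin.cons n (Function.update w j u)) := by
  have h := f.toAlternatingMap.map_swap (Fin.cons n (Function.update w j u))
    (Fin.succ_ne_zero j).symm
  simp only [ContinuousAlternatingMap.coe_toAlternatingMap] at h
  rw [← h]
  congr 1
  funext s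
  refine Fin.cases ?_ (fun i ↦ ?_) s
  · simp
  · by_cases hij : i = j
    · subst hij; simp [Function.update_of_ne (Fin.succ_ne_zero i).symm]
    · have : Equiv.swap 0 j.succ i.succ = i.succ :=
        Equiv.swap_apply_of_ne_of_ne (Fin.succ_ne_zero i) (by simpa using hij)
      simp [this, hij]

/-! ### The Maxwell equations for an aligned form -/

theorem forall_cons {α : Type*} {k : ℕ} {P : α → Prop} {u : α} {w : Fin k → α} (hu : P u)
    (hw : ∀ j, P (w j)) (r : Fin (k + 1)) : P ((Fin.cons u w : Fin (k + 1) → α) r) := by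
  refine Fin.cases ?_ (fun j ↦ ?_) r
  · simpa using hu
  · simpa using hw j

theorem forall_update {α : Type*} {k : ℕ} {P : α → Prop} {u : α} {w : Fin k → α} (hu : P u)
    (hw : ∀ j, P (w j)) (r s : Fin k) : P (Function.update w r u s) := by
  by_cases h : s = r
  · subst h; simpa using hu
  · simpa [h] using hw s

section Aligned

variable {p : ℕ} {g : LorentzMetric d M} {l : Π x : M, TangentSpace (𝓡 d) x}
  {F : Form d M (p + 1)} {x : M}

/-- The vector `∇_ℓ ℓ` is null if `F` does not vanish. -/
theorem val_accel_accel_eq_zero (hd : 2 ≤ d) (hl : IsSmoothField l)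
    (hnull : ∀ x, g.IsNull (l x)) (hF : IsMaxwell g F) (hal : IsMultiplyAligned g F l)
    (hx : F x ≠ 0) (e : NullFrame g x) (he : e.ell = l x) :
    g.val x (g.leviCivita l x (l x)) (g.leviCivita l x (l x)) = 0 := by
  have hmem := fun y (w : Fin (p + 1) → TangentSpace (𝓡 d) y) r ↦
    hal.apply_eq_zero_of_mem hd y (w := w) r
  have horth := fun y (w : Fin (p + 1) → TangentSpace (𝓡 d) y) ↦
    hal.apply_eq_zero_of_orthogonal hd y (w := w)
  have hL := g.val_leviCivita_self hl (fun y ↦ (hnull y).2) x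
  have hn : g.val x (l x) e.n = 1 := by rw [← he, e.ell_n]
  have hm : ∀ i, g.val x (l x) (e.m i) = 0 := by rw [← he]; exact e.ell_m
  set K := g.leviCivita l x (l x) with hK
  obtain ⟨I, -, hI⟩ := hal.exists_apply_ne_zero hd hx e he
  set w : Fin p → TangentSpace (𝓡 d) x := fun j ↦ e.m (I j) with hw
  have hwl : ∀ j, g.val x (l x) (w j) = 0 := fun j ↦ hm _
  have hzl := forall_cons (P := fun u ↦ g.val x (l x) u = 0) (hL (l x)) hwl
  -- All arguments, and every ∇_v ℓ, are orthogonal to ℓ, so only the first term of the Lie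
  -- derivative can survive.
  have h1 : covDeriv g F x (l x) (Fin.cons K w) = 0 := by
    have h := covDeriv_add_sum_eq_zero hF.smooth hl hmem (Fin.cons K w)
      (hF.antisymmDeriv_eq_zero x _)
    rwa [Finset.sum_eq_zero, add_zero] at h
    exact fun i _ ↦ horth x _
      (forall_update (P := fun u ↦ g.val x (l x) u = 0) (hL _) hzl i)
  have h2 : ∀ j, F x (Fin.cons e.n (Function.update w j K)) = 0 := by
    intro j
    -- With ℓ in slot j, each derivative lands on that ℓ. The m_i-terms have all arguments
    -- orthogonal to ℓ, and one further term contains ℓ; what is left is −F(n, …, K, …).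
    have h := e.divergence_eq hd (w := Function.update w j (l x)) fun b ↦
      hF.divergence_eq_zero x b _
    have hul := forall_update (P := fun u ↦ g.val x (l x) u = 0) (hL (l x)) hwl j
    have hj : ∀ u : TangentSpace (𝓡 d) x, (Fin.cons u (Function.update w j (l x)) :
      Fin (p + 1) → TangentSpace (𝓡 d) x) j.succ = l x := by simp
    have hD := fun v u ↦ covDeriv_of_apply_eq_zero (g := g) hF.smooth hl hmem v _ j.succ (hj u)
    simp only [hD] at h
    simp only [← Fin.cons_update, Function.update_idem] at h
    rw [Finset.sum_eq_zero, hmem x (Fin.cons e.ell _) 0 (by simp [he]), he] at h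
    · simpa using h
    · intro i _
      rw [horth x _ (forall_cons (P := fun u ↦ g.val x (l x) u = 0) (hm i)
        (forall_update (P := fun u ↦ g.val x (l x) u = 0) (hL _) hwl j)), neg_zero]
  -- The slot of K contributes g(K, K) φ; the other slots contribute multiples of F(n, …, K, …),
  -- which vanish by `h2`.
  rw [covDeriv_of_orthogonal hF.smooth hl horth hn hzl, Fin.sum_univ_succ,
    Finset.sum_eq_zero, add_zero] at h1
  · simp only [Fin.cons_zero, Fin.update_cons_zero] at h1
    exact (mul_eq_zero.1 h1).resolve_right hI
  · intro j _
    rw [← Fin.cons_update, apply_cons_update_swap, h2, neg_zero, mul_zero]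

/-- For K orthogonal to ℓ the frame expansion gives g(K, K) = ∑ (m_i · K)², a sum of squares. -/
theorem val_m_leviCivita_eq_zero (hd : 2 ≤ d) (e : NullFrame g x) {K : TangentSpace (𝓡 d) x}
    (hK : g.val x e.ell K = 0) (h0 : g.val x K K = 0) (i : Fin (d - 2)) :
    g.val x (e.m i) K = 0 := by
  have h : g.val x K K = ∑ i, g.val x (e.m i) K * g.val x (e.m i) K := by
    conv_lhs => enter [1]; rw [e.eq_sum hd K]
    simp [hK]
  rw [h0, eq_comm, Finset.sum_eq_zero_iff_of_nonneg fun i _ ↦ mul_self_nonneg _] at h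
  exact mul_self_eq_zero.1 (h i (Finset.mem_univ i))

/-- The eigenvalue equation for the components `φ_{i₁ … i_p} = F(n, m_{i₁}, …, m_{i_p})`: the
derivation of the exterior algebra induced by `2 ρ_(ij)` acts on `φ` as multiplication by the trace
of `ρ`. -/
theorem trace_rho_mul_eq (hd : 2 ≤ d) (hl : IsSmoothField l)
    (hnull : ∀ x, g.IsNull (l x)) (hF : IsMaxwell g F) (hal : IsMultiplyAligned g F l)
    (e : NullFrame g x) (he : e.ell = l x) (I : Fin p → Fin (d - 2)) :
    (e.rho l).trace * F x (Fin.cons e.n fun j ↦ e.m (I j))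
      = 2 * ∑ j, ∑ i, e.rhoSymm l i (I j) *
          F x (Fin.cons e.n (Function.update (fun j ↦ e.m (I j)) j (e.m i))) := by
  have hmem := fun y (w : Fin (p + 1) → TangentSpace (𝓡 d) y) r ↦
    hal.apply_eq_zero_of_mem hd y (w := w) r
  have horth := fun y (w : Fin (p + 1) → TangentSpace (𝓡 d) y) ↦
    hal.apply_eq_zero_of_orthogonal hd y (w := w)
  have hL := g.val_leviCivita_self hl (fun y ↦ (hnull y).2) x
  have hn : g.val x (l x) e.n = 1 := by rw [← he, e.ell_n]
  have hm : ∀ i, g.val x (l x) (e.m i) = 0 := by rw [← he]; exact e.ell_m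
  set w : Fin p → TangentSpace (𝓡 d) x := fun j ↦ e.m (I j) with hw
  have hwl : ∀ j, g.val x (l x) (w j) = 0 := fun j ↦ hm _
  -- The Lie derivative equation on (n, m, …, m): ∇_{m_j} ℓ is expanded in the frame, where its
  -- ℓ-part is killed by `F` and its n-part is zero.
  have h1 : covDeriv g F x (l x) (Fin.cons e.n w)
      + ∑ j, ∑ i, e.rho l i (I j) * F x (Fin.cons e.n (Function.update w j (e.m i))) = 0 := by
    have h := covDeriv_add_sum_eq_zero hF.smooth hl hmem (Fin.cons e.n w)
      (hF.antisymmDeriv_eq_zero x _)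
    rw [Fin.sum_univ_succ, Fin.update_cons_zero,
      horth x (Fin.cons _ w) (forall_cons (P := fun u ↦ g.val x (l x) u = 0) (hL _) hwl),
      zero_add] at h
    rw [← h]
    congr 1
    refine Finset.sum_congr rfl fun j _ ↦ ?_
    have h2 := e.eq_sum hd (g.leviCivita l x (e.m (I j)))
    rw [he, hL, zero_smul, add_zero] at h2
    have h3 : (Fin.cons e.n w : Fin (p + 1) → TangentSpace (𝓡 d) x) j.succ = e.m (I j) := by
      simp [hw]
    rw [h3, h2, ContinuousAlternatingMap.map_update_add, ContinuousAlternatingMap.map_update_smul,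
      hmem x (Function.update _ _ (l x)) j.succ (by simp), smul_zero, zero_add]
    have h4 := fun u ↦ (F x).toContinuousLinearMap_apply (Fin.cons e.n w) j.succ u
    rw [← h4, map_sum]
    simp only [h4, ContinuousAlternatingMap.map_update_smul, Fin.cons_update, smul_eq_mul]
    rfl
  -- The divergence equation: the derivatives along m_i give the trace from the contracted slot, and
  -- the transpose of ρ, with a minus sign, from the others.
  have h2 : covDeriv g F x (l x) (Fin.cons e.n w)
      + ((e.rho l).trace * F x (Fin.cons e.n w)
        - ∑ j, ∑ i, e.rho l (I j) i * F x (Fin.cons e.n (Function.update w j (e.m i)))) = 0 := by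
    have h := e.divergence_eq hd (w := w) fun b ↦ hF.divergence_eq_zero x b _
    rw [covDeriv_of_apply_eq_zero hF.smooth hl hmem e.n (Fin.cons e.ell w) 0 (by simp [he]),
      Fin.update_cons_zero,
      horth x (Fin.cons _ w) (forall_cons (P := fun u ↦ g.val x (l x) u = 0) (hL _) hwl),
      neg_zero, add_zero, he] at h
    rw [← h]
    congr 1
    rw [Finset.sum_comm, Matrix.trace, Finset.sum_mul, ← Finset.sum_sub_distrib]
    refine Finset.sum_congr rfl fun i _ ↦ ?_
    rw [covDeriv_of_orthogonal hF.smooth hl horth hn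
      (forall_cons (P := fun u ↦ g.val x (l x) u = 0) (hm i) hwl), Fin.sum_univ_succ]
    rw [sub_eq_add_neg, ← Finset.sum_neg_distrib, Fin.cons_zero, Fin.update_cons_zero, g.symm x]
    congr 1
    refine Finset.sum_congr rfl fun j _ ↦ ?_
    rw [← Fin.cons_update, apply_cons_update_swap _ _ _ (e.m i), Fin.cons_succ, g.symm x, mul_neg]
    rfl
  have h3 : 2 * ∑ j, ∑ i, e.rhoSymm l i (I j) * F x (Fin.cons e.n (Function.update w j (e.m i)))
      = ∑ j, ∑ i, e.rho l i (I j) * F x (Fin.cons e.n (Function.update w j (e.m i)))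
      + ∑ j, ∑ i, e.rho l (I j) i * F x (Fin.cons e.n (Function.update w j (e.m i))) := by
    simp only [← Finset.sum_add_distrib, Finset.mul_sum, NullFrame.rhoSymm, Matrix.smul_apply,
      Matrix.add_apply, Matrix.transpose_apply, smul_eq_mul]
    exact Finset.sum_congr rfl fun j _ ↦ Finset.sum_congr rfl fun i _ ↦ by ring
  rw [h3]
  linarith

end Aligned

/-! ### Diagonalizing the symmetric part of the optical matrix -/

namespace NullFrame

variable {g : LorentzMetric d M} {x : M}

/-- The null frame obtained by a rotation of the spatial vectors. -/
noncomputable def rotate (e : NullFrame g x) (U : Matrix (Fin (d - 2)) (Fin (d - 2)) ℝ)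
    (hU : U.transpose * U = 1) : NullFrame g x where
  ell := e.ell
  n := e.n
  m a := ∑ i, U i a • e.m i
  ell_ell := e.ell_ell
  n_n := e.n_n
  ell_n := e.ell_n
  ell_m a := by simp [e.ell_m]
  n_m a := by simp [e.n_m]
  m_m a b := by
    have h := congrFun (congrFun hU a) b
    simp only [Matrix.mul_apply, Matrix.transpose_apply, Matrix.one_apply] at h
    simp [e.m_m, ← h, mul_comm]

theorem rho_rotate (e : NullFrame g x) (l : Π x : M, TangentSpace (𝓡 d) x)
    (U : Matrix (Fin (d - 2)) (Fin (d - 2)) ℝ) (hU : U.transpose * U = 1) :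
    (e.rotate U hU).rho l = U.transpose * e.rho l * U := by
  ext a b
  simp only [rho, rotate, Matrix.of_apply, Matrix.mul_apply, Matrix.transpose_apply, map_sum,
    map_smul, sum_apply, smul_apply, smul_eq_mul, Finset.mul_sum, Finset.sum_mul]
  exact Finset.sum_congr rfl fun i _ ↦ Finset.sum_congr rfl fun j _ ↦ by ring

theorem rhoSymm_rotate (e : NullFrame g x) (l : Π x : M, TangentSpace (𝓡 d) x)
    (U : Matrix (Fin (d - 2)) (Fin (d - 2)) ℝ) (hU : U.transpose * U = 1) :
    (e.rotate U hU).rhoSymm l = U.transpose * e.rhoSymm l * U := by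
  simp only [rhoSymm, rho_rotate, Matrix.transpose_mul, Matrix.transpose_transpose,
    Matrix.mul_smul, Matrix.smul_mul, Matrix.mul_add, Matrix.add_mul, Matrix.mul_assoc]

theorem trace_rhoSymm (e : NullFrame g x) (l : Π x : M, TangentSpace (𝓡 d) x) :
    (e.rhoSymm l).trace = (e.rho l).trace := by
  simp only [rhoSymm, Matrix.trace_smul, Matrix.trace_add, Matrix.trace_transpose, smul_eq_mul]
  ring

/-- The spectral theorem: the real eigenvector matrix is orthogonal, so it defines a rotation of the
spatial vectors that leaves ℓ and n fixed. -/
theorem exists_rhoSymm_eq_diagonal (e : NullFrame g x) (l : Π x : M, TangentSpace (𝓡 d) x) :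
    ∃ e' : NullFrame g x, e'.ell = e.ell ∧
      e'.rhoSymm l = Matrix.diagonal (e.isHermitian_rhoSymm l).eigenvalues := by
  set h := e.isHermitian_rhoSymm l
  let U : Matrix (Fin (d - 2)) (Fin (d - 2)) ℝ := h.eigenvectorUnitary
  have hUs : star U = U.transpose := Matrix.conjTranspose_eq_transpose_of_trivial U
  have hU : U.transpose * U = 1 := by
    rw [← hUs]; exact Unitary.coe_star_mul_self h.eigenvectorUnitary
  refine ⟨e.rotate U hU, rfl, ?_⟩
  rw [rhoSymm_rotate, ← hUs]
  have h1 := h.conjStarAlgAut_star_eigenvectorUnitary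
  rw [Unitary.conjStarAlgAut_star_apply] at h1
  exact h1

end NullFrame

end Spacetime

/-! ### The main theorem -/

open Spacetime in
theorem mainTheorem1 {d p : ℕ} (hp : 0 < p) (hpd : p + 2 < d)
    {M : Type*} [TopologicalSpace M] [ChartedSpace (EuclideanSpace ℝ (Fin d)) M]
    [IsManifold (𝓡 d) ∞ M] (g : Spacetime.LorentzMetric d M)
    (l : Π x : M, TangentSpace (𝓡 d) x) (hl : Spacetime.IsSmoothField l)
    (hnull : ∀ x, g.IsNull (l x))
    (F : Spacetime.Form d M (p + 1)) (hF : Spacetime.IsMaxwell g F)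
    (hal : Spacetime.IsMultiplyAligned g F l) (x : M) (hx : F x ≠ 0) :
    (∃ c : ℝ, g.leviCivita l x (l x) = c • l x) ∧
    ∀ e : Spacetime.NullFrame g x, e.ell = l x →
      (∀ i, e.kappa l i = 0) ∧
      ∃ s : Finset (Fin (d - 2)), s.card = p ∧ sᶜ.card = d - 2 - p ∧
        ∑ i ∈ s, (e.isHermitian_rhoSymm l).eigenvalues i = (e.rho l).trace / 2 ∧
        ∑ i ∈ sᶜ, (e.isHermitian_rhoSymm l).eigenvalues i = (e.rho l).trace / 2 := by
  have hd : 2 ≤ d := by omega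
  have hL := g.val_leviCivita_self hl (fun y ↦ (hnull y).2) x
  have hkappa : ∀ e : Spacetime.NullFrame g x, e.ell = l x →
      ∀ i, g.val x (e.m i) (g.leviCivita l x (l x)) = 0 := fun e he ↦
    val_m_leviCivita_eq_zero hd e (by rw [he]; exact hL _)
      (val_accel_accel_eq_zero hd hl hnull hF hal hx e he)
  refine ⟨?_, fun e he ↦ ⟨fun i ↦ ?_, ?_⟩⟩
  · obtain ⟨e, he, -⟩ := hal x
    refine ⟨g.val x e.n (g.leviCivita l x (l x)), ?_⟩
    conv_lhs => rw [e.eq_sum hd (g.leviCivita l x (l x))]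
    simp [hkappa e he, he, hL]
  · rw [NullFrame.kappa, he, hkappa e he]
  · obtain ⟨e', he', hdiag⟩ := e.exists_rhoSymm_eq_diagonal l
    -- Injectivity of I makes its image a set of exactly p eigenvalue indices.
    obtain ⟨I, hI, hne⟩ := hal.exists_apply_ne_zero hd hx e' (he'.trans he)
    set ev := (e.isHermitian_rhoSymm l).eigenvalues
    have htr : (e.rho l).trace = ∑ i, ev i := by
      rw [← e.trace_rhoSymm, (e.isHermitian_rhoSymm l).trace_eq_sum_eigenvalues]
      rfl
    have htr' : (e'.rho l).trace = ∑ i, ev i := by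
      rw [← e'.trace_rhoSymm, hdiag, Matrix.trace_diagonal]
    have h1 := trace_rho_mul_eq hd hl hnull hF hal e' (he'.trans he) I
    rw [hdiag] at h1
    simp only [Matrix.diagonal_apply, ite_mul, zero_mul, Finset.sum_ite_eq', Finset.mem_univ,
      if_true, Function.update_eq_self, ← Finset.sum_mul, ← mul_assoc] at h1
    -- In the diagonalizing frame the equation reads trace · φ_I = 2 (∑ eigenvalues over I) · φ_I,
    -- so the non-zero φ_I can be cancelled.
    have h2 := mul_right_cancel₀ hne h1
    have h3 : ∑ i ∈ Finset.univ.map ⟨I, hI⟩, ev i = (e.rho l).trace / 2 := by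
      rw [Finset.sum_map, htr, ← htr', h2]
      simp
    have hcard : (Finset.univ.map ⟨I, hI⟩).card = p := by simp
    refine ⟨Finset.univ.map ⟨I, hI⟩, hcard, by rw [Finset.card_compl, hcard]; simp, h3, ?_⟩
    have h4 := Finset.sum_add_sum_compl (Finset.univ.map ⟨I, hI⟩) ev
    rw [h3, ← htr] at h4
    linarith
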